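/- **Theorem (Maximum Matching Rounding).** There is an absolute constant $C>0$ such that the following holds. Let $V$ be a finite vertex set, $n=|V|$, and let $\delta\in(0,1)$ and $\alpha\ge 1$ be real numbers. There is a randomized dynamic rounding scheme on $V$ with the following guarantees. Its input is a sequence of graphs $G^t=(V,E^t)$ and vectors $x^t\in\mathbb{R}^{\binom V2}$, revealed one time step $t$ at a time. The sequence is fixed in advance, independently of the random choices of the scheme (oblivious adversary). The scheme draws a random seed whose distribution does not depend on the input, starts with $M^0=\emptyset$, and at each time $t$ outputs a set of edges $M^t$ that depends only on the seed and on the input revealed up to time $t$. Let $T\ge 0$, let $x^0=0$, and suppose that for every $t\in[T]=\{1,\dots,T\}$ the graph $G^t$ is bipartite and $x^t$ is a fractional matching of $G^t$, that is, $x^t\ge 0$, $x^t_e=0$ for $e\notin E^t$, and $\sum_{e\ni v}x^t_e\le 1$ for every $v\in V$. The edge sets $E^t$ may change arbitrarily from one step to the next (in particular, by the insertion or deletion of single edges). Then $M^t$ is always a matching of $G^t$ for every $t\in[T]$, and $$\mathbb{E}\Big[\sum_{t\in[T]}|M^t\oplus M^{t-1}|\Big]\;\le\; C\cdot\frac{\alpha\log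 n}{\delta^3}\cdot\sum_{t\in[T]}\|x^t-x^{t-1}\|_1\;+\;C\cdot\frac{T}{\delta\, n^{\alpha}},$$ $$\mathbb{E}\big[|M^t|\big]\;\ge\;(1-\delta)\sum_{e\in E^t}x^t_e\qquad\text{for all } t\in[T].$$ Here $\oplus$ is the symmetric difference and $\log$ is the natural logarithm. (For $n=0$ the term $T/(\delta n^\alpha)$ is read as $0$.) -/

import Mathlib

open MeasureTheory

universe u

/-- What is revealed at one time step: the current graph, and the current fractional solution, with
one coordinate for each unordered pair of vertices. (`Sym2 V` also contains the degenerate pairs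
`s(v, v)`; they are never edges, so a fractional matching vanishes there.) -/
structure Snapshot (V : Type u) where
  graph : SimpleGraph V
  frac : Sym2 V → ℝ

/-- `x` is a fractional matching of `G`: it is nonnegative, it vanishes on the pairs that are not
edges of `G`, and the total value at each vertex is at most one. -/
structure IsFractionalMatching {V : Type u} [Fintype V] [DecidableEq V]
    (G : SimpleGraph V) (x : Sym2 V → ℝ) : Prop where
  nonneg : ∀ e, 0 ≤ x e
  eq_zero_of_notMem : ∀ e, e ∉ G.edgeSet → x e = 0
  degree_le_one : ∀ v : V, ∑ e : Sym2 V with v ∈ e, x e ≤ 1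

open Classical in
/-- The value `∑_{e ∈ E} x_e` of a fractional solution on `G = (V, E)`. -/
noncomputable def fractionalValue {V : Type u} [Fintype V] [DecidableEq V]
    (G : SimpleGraph V) (x : Sym2 V → ℝ) : ℝ :=
  ∑ e : Sym2 V with e ∈ G.edgeSet, x e

/-- The `ℓ¹` distance between two fractional solutions. -/
def l1Dist {V : Type u} [Fintype V] [DecidableEq V] (x y : Sym2 V → ℝ) : ℝ :=
  ∑ e : Sym2 V, |x e - y e|

/-- `M` is an (integral) matching of `G`: a set of edges of `G`, no two of which share an
endpoint. -/
def IsMatchingOf {V : Type u} (G : SimpleGraph V) (M : Finset (Sym2 V)) : Prop :=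
  (∀ e ∈ M, e ∈ G.edgeSet) ∧ ∀ e ∈ M, ∀ f ∈ M, ∀ v : V, v ∈ e → v ∈ f → e = f

/-- A randomized dynamic rounding scheme on the vertex set `V`, against an oblivious adversary.
It draws a random seed `ω` from a probability space that does not depend on the input. On the
input sequence `I`, it holds the edge set `sol I t ω` at time `t`; this set is empty at time `0` and
depends only on the seed and on the part of the input that has been revealed by time `t`. -/
structure RoundingScheme (V : Type u) where
  Ω : Type u
  [measurableSpace : MeasurableSpace Ω]
  P : Measure Ω
  [isProbabilityMeasure : IsProbabilityMeasure P]
  sol : (ℕ → Snapshot V) → ℕ → Ω → Finset (Sym2 V)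
  sol_zero : ∀ I ω, sol I 0 ω = ∅
  causal : ∀ (I J : ℕ → Snapshot V) (t : ℕ), (∀ s ≤ t, I s = J s) → sol I t = sol J t
  measurableSet_sol : ∀ (I : ℕ → Snapshot V) (t : ℕ) (M : Finset (Sym2 V)),
    MeasurableSet {ω | sol I t ω = M}

attribute [instance] RoundingScheme.measurableSpace RoundingScheme.isProbabilityMeasure

namespace RoundingScheme

variable {V : Type u}

/-- The expected total recourse `𝔼[∑_{t=1}^T |M^t ⊕ M^{t-1}|]` of the scheme on the input `I`. -/
noncomputable def expectedRecourse [DecidableEq V] (R : RoundingScheme V)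
    (I : ℕ → Snapshot V) (T : ℕ) : ℝ :=
  ∫ ω, ∑ t ∈ Finset.Icc 1 T, ((symmDiff (R.sol I t ω) (R.sol I (t - 1) ω)).card : ℝ) ∂(R.P)

/-- The expected size `𝔼[|M^t|]` of the edge set that the scheme holds at time `t`. -/
noncomputable def expectedSize (R : RoundingScheme V) (I : ℕ → Snapshot V) (t : ℕ) : ℝ :=
  ∫ ω, ((R.sol I t ω).card : ℝ) ∂(R.P)

end RoundingScheme

namespace MatchingRounding

open ProbabilityTheory

/-! ### Matchings inside a finite set of unordered pairs -/

/-! Give each pair one uniform threshold, fixed for all time, and keep the edges with threshold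
below `L * x e`, where `L` is of order `1/δ²`. The kept set changes by at most `L` times the ℓ¹
movement of `x` in expectation. No concentration with a union bound is needed, since only expected
sizes matter: the bounds proved have no factor `log n` and no additive term.

The kept edges contain a nearly optimal matching (`le_integral_of_matching_le`). The unbiased
weights `thresholdWeight` have variance at most `x e / L`. By König's theorem the largest matching
falls short of their total by at most the summed excess of the weighted degrees over one.
`max_sub_one_le` makes the expected excess at a vertex a small multiple of its fractional degree, so
the total loss is proportional to the value of `x`.

Inside the kept edges, each matching maximizes `K * |M|` minus the change, with `K` of order `1/δ`.
This costs a factor `(K + 1) / (K - 1)` in size, and a potential argument bounds the recourse by `K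
+ 1` times that of the kept set. -/

/-- No two distinct members of `M` share an endpoint. -/
def PairwiseVertexDisjoint {V : Type u} (M : Finset (Sym2 V)) : Prop :=
  ∀ e ∈ M, ∀ f ∈ M, ∀ v : V, v ∈ e → v ∈ f → e = f

lemma PairwiseVertexDisjoint.mono {V : Type u} {M N : Finset (Sym2 V)}
    (hN : PairwiseVertexDisjoint N) (h : M ⊆ N) : PairwiseVertexDisjoint M :=
  fun e he f hf => hN e (h he) f (h hf)

lemma exists_maximizing_matching {V : Type u} (F : Finset (Sym2 V))
    (score : Finset (Sym2 V) → ℝ) :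
    ∃ M ⊆ F, PairwiseVertexDisjoint M ∧
      ∀ N ⊆ F, PairwiseVertexDisjoint N → score N ≤ score M := by
  classical
  obtain ⟨M, hM, hmax⟩ := (F.powerset.filter PairwiseVertexDisjoint).exists_max_image score
    ⟨∅, by simp [PairwiseVertexDisjoint]⟩
  simp only [Finset.mem_filter, Finset.mem_powerset] at hM hmax
  exact ⟨M, hM.1, hM.2, fun N hN hd => hmax N ⟨hN, hd⟩⟩

/-- A matching `M` inside `F` that maximizes `K |M| - |M ∆ M₀|`, where `M₀` is the previous
matching. -/
noncomputable def lazyMatching {V : Type u} [DecidableEq V] (K : ℝ) (F M₀ : Finset (Sym2 V)) :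
    Finset (Sym2 V) :=
  (exists_maximizing_matching F fun M => K * M.card - (symmDiff M M₀).card).choose

section lazyMatching

variable {V : Type u} [DecidableEq V] (K : ℝ) (F M₀ : Finset (Sym2 V))

lemma lazyMatching_subset : lazyMatching K F M₀ ⊆ F :=
  (exists_maximizing_matching F fun M => K * M.card - (symmDiff M M₀).card).choose_spec.1

lemma lazyMatching_pairwiseVertexDisjoint : PairwiseVertexDisjoint (lazyMatching K F M₀) :=
  (exists_maximizing_matching F fun M => K * M.card - (symmDiff M M₀).card).choose_spec.2.1

lemma le_lazyMatching {N : Finset (Sym2 V)} (hN : N ⊆ F) (hd : PairwiseVertexDisjoint N) :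
    K * N.card - (symmDiff N M₀).card ≤
      K * (lazyMatching K F M₀).card - (symmDiff (lazyMatching K F M₀) M₀).card :=
  (exists_maximizing_matching F fun M => K * M.card - (symmDiff M M₀).card).choose_spec.2.2 N hN hd

/-- Switching to `N` would raise the change term by at most `|N ∆ M| ≤ |N| + |M|`; optimality of `M`
does the rest. -/
lemma card_le_card_lazyMatching {N : Finset (Sym2 V)} (hN : N ⊆ F)
    (hd : PairwiseVertexDisjoint N) :
    (K - 1) * N.card ≤ (K + 1) * (lazyMatching K F M₀).card := by
  have h := le_lazyMatching K F M₀ hN hd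
  set M := lazyMatching K F M₀
  have hsub : symmDiff N M₀ ⊆ (N ∪ M) ∪ symmDiff M M₀ := by
    intro e
    simp only [Finset.mem_symmDiff, Finset.mem_union]
    tauto
  have hc : (symmDiff N M₀).card ≤ N.card + M.card + (symmDiff M M₀).card :=
    (Finset.card_le_card hsub).trans ((Finset.card_union_le _ _).trans
      (Nat.add_le_add_right (Finset.card_union_le _ _) _))
  have hc' : ((symmDiff N M₀).card : ℝ) ≤ N.card + M.card + (symmDiff M M₀).card := by
    exact_mod_cast hc
  linarith

/-- Compare with the candidate `M₀ ∩ F`, which only drops the deleted edges. The term in `K`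
telescopes over time. -/
lemma card_symmDiff_lazyMatching_le (hK : 0 ≤ K) {F₀ : Finset (Sym2 V)} (h₀ : M₀ ⊆ F₀)
    (hd : PairwiseVertexDisjoint M₀) :
    ((symmDiff (lazyMatching K F M₀) M₀).card : ℝ) ≤
      K * ((lazyMatching K F M₀).card - M₀.card) + (K + 1) * (F₀ \ F).card := by
  have h := le_lazyMatching K F M₀ (Finset.inter_subset_right (s₁ := M₀))
    (hd.mono Finset.inter_subset_left)
  have hs : symmDiff (M₀ ∩ F) M₀ = M₀ \ F := by
    ext e
    simp only [Finset.mem_symmDiff, Finset.mem_inter, Finset.mem_sdiff]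
    tauto
  rw [hs] at h
  have hc : ((M₀ ∩ F).card : ℝ) + (M₀ \ F).card = M₀.card := by
    exact_mod_cast Finset.card_inter_add_card_sdiff M₀ F
  have hle : ((M₀ \ F).card : ℝ) ≤ (F₀ \ F).card := by
    exact_mod_cast Finset.card_le_card (Finset.sdiff_subset_sdiff h₀ le_rfl)
  have := mul_le_mul_of_nonneg_left hle (by linarith : 0 ≤ K + 1)
  nlinarith

end lazyMatching

/-- The matchings obtained by applying `lazyMatching` successively to the edge sets
`F 1, F 2, …`, starting from the empty matching. -/
noncomputable def lazyMatchings {V : Type u} [DecidableEq V] (K : ℝ)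
    (F : ℕ → Finset (Sym2 V)) : ℕ → Finset (Sym2 V)
  | 0 => ∅
  | t + 1 => lazyMatching K (F (t + 1)) (lazyMatchings K F t)

section lazyMatchings

variable {V : Type u} [DecidableEq V] (K : ℝ) (F : ℕ → Finset (Sym2 V))

lemma lazyMatchings_subset (t : ℕ) : lazyMatchings K F t ⊆ F t := by
  cases t with
  | zero => simp [lazyMatchings]
  | succ t => exact lazyMatching_subset _ _ _

lemma lazyMatchings_pairwiseVertexDisjoint (t : ℕ) :
    PairwiseVertexDisjoint (lazyMatchings K F t) := by
  cases t with
  | zero => simp [lazyMatchings, PairwiseVertexDisjoint]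
  | succ t => exact lazyMatching_pairwiseVertexDisjoint _ _ _

lemma lazyMatchings_congr {F F' : ℕ → Finset (Sym2 V)} {t : ℕ} (h : ∀ s ≤ t, F s = F' s) :
    lazyMatchings K F t = lazyMatchings K F' t := by
  induction t with
  | zero => rfl
  | succ t ih =>
    simp only [lazyMatchings]
    rw [h (t + 1) le_rfl, ih fun s hs => h s (by omega)]

lemma card_le_card_lazyMatchings {t : ℕ} (ht : 1 ≤ t) {N : Finset (Sym2 V)} (hN : N ⊆ F t)
    (hd : PairwiseVertexDisjoint N) :
    (K - 1) * N.card ≤ (K + 1) * (lazyMatchings K F t).card := by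
  obtain ⟨t, rfl⟩ := Nat.exists_eq_add_of_le' ht
  exact card_le_card_lazyMatching _ _ _ hN hd

/-- The total recourse of the lazy matchings is at most `K + 1` times that of the edge sets. -/
lemma sum_card_symmDiff_lazyMatchings_le (hK : 0 ≤ K) (h0 : F 0 = ∅) (T : ℕ) :
    ∑ t ∈ Finset.Icc 1 T,
        ((symmDiff (lazyMatchings K F t) (lazyMatchings K F (t - 1))).card : ℝ) ≤
      (K + 1) * ∑ t ∈ Finset.Icc 1 T, ((symmDiff (F t) (F (t - 1))).card : ℝ) := by
  -- The potential `K * (|F| - |M|)` starts at zero and stays nonnegative. An insertion into `F` is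
  -- charged `K`, while a deletion costs at most `K + 1`.
  have key : ∑ t ∈ Finset.Icc 1 T,
        ((symmDiff (lazyMatchings K F t) (lazyMatchings K F (t - 1))).card : ℝ) +
        K * ((F T).card - (lazyMatchings K F T).card) ≤
      (K + 1) * ∑ t ∈ Finset.Icc 1 T, ((symmDiff (F t) (F (t - 1))).card : ℝ) := by
    induction T with
    | zero => simp [h0, lazyMatchings]
    | succ T ih =>
      rw [Finset.sum_Icc_succ_top (by omega), Finset.sum_Icc_succ_top (by omega)]
      have h := card_symmDiff_lazyMatching_le K (F (T + 1)) _ hK (lazyMatchings_subset K F T)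
        (lazyMatchings_pairwiseVertexDisjoint K F T)
      simp only [Nat.add_sub_cancel]
      rw [show lazyMatchings K F (T + 1) = lazyMatching K (F (T + 1)) (lazyMatchings K F T)
        from rfl]
      have h1 : ((symmDiff (F (T + 1)) (F T)).card : ℝ) =
          (F (T + 1) \ F T).card + (F T \ F (T + 1)).card := by
        rw [symmDiff_def, Finset.sup_eq_union, Finset.card_union_of_disjoint disjoint_sdiff_sdiff]
        push_cast; rfl
      have h2 : ((F (T + 1)).card : ℝ) ≤ (F T).card + (F (T + 1) \ F T).card := by
        have : F (T + 1) ⊆ F T ∪ (F (T + 1) \ F T) := by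
          rw [Finset.union_sdiff_self_eq_union]; exact Finset.subset_union_right
        exact_mod_cast (Finset.card_le_card this).trans (Finset.card_union_le _ _)
      have h3 := mul_le_mul_of_nonneg_left h2 hK
      have h4 : (0 : ℝ) ≤ ((F (T + 1) \ F T).card : ℝ) := Nat.cast_nonneg _
      rw [h1]
      nlinarith
  have hc : ((lazyMatchings K F T).card : ℝ) ≤ (F T).card := by
    exact_mod_cast Finset.card_le_card (lazyMatchings_subset K F T)
  nlinarith

end lazyMatchings

/-! ### König's theorem -/

section Konig

variable {V : Type u} [Fintype V] [DecidableEq V]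

/-- **König's theorem**: a bipartite set of edges has a matching and a vertex cover of the same
size. -/
theorem exists_matching_card_eq_cover (F : Finset (Sym2 V)) (side : V → Bool)
    (hF : ∀ v w, s(v, w) ∈ F → side v ≠ side w) :
    ∃ N ⊆ F, PairwiseVertexDisjoint N ∧
      ∃ C : Finset V, (∀ e ∈ F, ∃ v ∈ C, v ∈ e) ∧ C.card = N.card := by
  classical
  let IsCover : Finset V → Prop := fun C => ∀ v w, s(v, w) ∈ F → v ∈ C ∨ w ∈ C
  obtain ⟨C, hC, hmin⟩ := (Finset.univ.filter IsCover).exists_min_image Finset.card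
    ⟨Finset.univ, by simp [IsCover]⟩
  simp only [Finset.mem_filter, Finset.mem_univ, true_and] at hC hmin
  -- Hall's theorem will match the minimum cover `C` into its complement.
  let nb : V → Finset V := fun v => Finset.univ.filter fun w => w ∉ C ∧ s(v, w) ∈ F
  -- No edge lies inside a one-sided `S`, so replacing `S` by its neighbors outside `C` leaves a
  -- cover; minimality gives Hall's condition.
  have hone : ∀ (b : Bool) (S : Finset V), S ⊆ C → (∀ v ∈ S, side v = b) →
      S.card ≤ (S.biUnion nb).card := by
    intro b S hS hb
    have hcov : IsCover ((C \ S) ∪ S.biUnion nb) := by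
      have aux : ∀ v w, s(v, w) ∈ F → v ∈ C →
          v ∈ (C \ S) ∪ S.biUnion nb ∨ w ∈ (C \ S) ∪ S.biUnion nb := by
        intro v w hvw hv
        have hne := hF v w hvw
        by_cases hvS : v ∈ S
        · right
          by_cases hw : w ∈ C
          · refine Finset.mem_union_left _ (Finset.mem_sdiff.2 ⟨hw, fun hwS => hne ?_⟩)
            rw [hb v hvS, hb w hwS]
          · refine Finset.mem_union_right _ (Finset.mem_biUnion.2 ⟨v, hvS, ?_⟩)
            simp [nb, hw, hvw]
        · left
          exact Finset.mem_union_left _ (Finset.mem_sdiff.2 ⟨hv, hvS⟩)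
      intro v w hvw
      rcases hC v w hvw with hv | hw
      · exact aux v w hvw hv
      · exact (aux w v (Sym2.eq_swap ▸ hvw) hw).symm
    have h1 := hmin _ hcov
    have h2 := Finset.card_union_le (C \ S) (S.biUnion nb)
    have h3 := Finset.card_sdiff_add_card_eq_card hS
    omega
  have hall : ∀ S : Finset C, S.card ≤ (S.biUnion fun v => nb v.1).card := by
    intro S
    let S' : Finset V := S.map (Function.Embedding.subtype _)
    have hS'C : S' ⊆ C := by
      intro v hv
      obtain ⟨w, _, rfl⟩ := Finset.mem_map.1 hv
      exact w.2
    have hcard : S.card = S'.card := (Finset.card_map _).symm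
    have hbi : (S.biUnion fun v => nb v.1) = S'.biUnion nb := by
      ext w; simp [S']
    rw [hcard, hbi]
    have ht := hone true (S'.filter fun v => side v = true) ((Finset.filter_subset _ _).trans hS'C)
      (by simp)
    have hf := hone false (S'.filter fun v => ¬ side v = true)
      ((Finset.filter_subset _ _).trans hS'C) (by simp)
    -- Neighbors of the two halves lie on opposite sides, so the two one-sided bounds add up.
    have hdis : Disjoint ((S'.filter fun v => side v = true).biUnion nb)
        ((S'.filter fun v => ¬ side v = true).biUnion nb) := by
      rw [Finset.disjoint_left]
      intro w hw hw'
      simp only [Finset.mem_biUnion, Finset.mem_filter, nb, Finset.mem_univ, true_and] at hw hw'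
      obtain ⟨a, ⟨_, ha⟩, _, haw⟩ := hw
      obtain ⟨a', ⟨_, ha'⟩, _, haw'⟩ := hw'
      have h1 := hF _ _ haw
      have h2 := hF _ _ haw'
      cases h : side w <;> simp_all
    have hsub : (S'.filter fun v => side v = true).biUnion nb ∪
        (S'.filter fun v => ¬ side v = true).biUnion nb ⊆ S'.biUnion nb :=
      Finset.union_subset (Finset.biUnion_subset_biUnion_of_subset_left _ (Finset.filter_subset _ _))
        (Finset.biUnion_subset_biUnion_of_subset_left _ (Finset.filter_subset _ _))
    have h4 := Finset.card_le_card hsub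
    rw [Finset.card_union_of_disjoint hdis] at h4
    have h5 := Finset.card_filter_add_card_filter_not (s := S') (fun v => side v = true)
    omega
  obtain ⟨f, hinj, hf⟩ :=
    (Finset.all_card_le_biUnion_card_iff_exists_injective fun v : C => nb v.1).1 hall
  have hf' : ∀ v : C, f v ∉ C ∧ s(v.1, f v) ∈ F := by
    intro v
    simpa [nb] using hf v
  have hdisj : ∀ v w : C, ∀ x : V, x ∈ s(v.1, f v) → x ∈ s(w.1, f w) → v = w := by
    intro v w x hv hw
    rw [Sym2.mem_iff] at hv hw
    rcases hv with rfl | rfl <;> rcases hw with h | h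
    · exact Subtype.ext h
    · exact absurd v.2 (h ▸ (hf' w).1)
    · exact absurd w.2 (h ▸ (hf' v).1)
    · exact hinj h
  refine ⟨Finset.univ.image fun v : C => s(v.1, f v), ?_, ?_, C, ?_, ?_⟩
  · intro e he
    obtain ⟨v, _, rfl⟩ := Finset.mem_image.1 he
    exact (hf' v).2
  · intro e he e' he' x hx hx'
    obtain ⟨v, _, rfl⟩ := Finset.mem_image.1 he
    obtain ⟨w, _, rfl⟩ := Finset.mem_image.1 he'
    rw [hdisj v w x hx hx']
  · intro e he
    induction e with
    | h v w =>
      rcases hC v w he with h | h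
      · exact ⟨v, h, by simp⟩
      · exact ⟨w, h, by simp⟩
  · rw [Finset.card_image_of_injective, Finset.card_univ, Fintype.card_coe]
    intro v w hvw
    refine hdisj v w v.1 (by simp) ?_
    simp only at hvw
    rw [← hvw]
    simp

/-- A bipartite edge set supporting nonnegative weights `y` has a matching of size at least the
total weight minus the total excess of the weighted degrees over one. -/
lemma exists_matching_ge_weight_sub_excess (F : Finset (Sym2 V)) (side : V → Bool)
    (hF : ∀ v w, s(v, w) ∈ F → side v ≠ side w) (y : Sym2 V → ℝ) (hy : ∀ e, 0 ≤ y e)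
    (hyF : ∀ e, e ∉ F → y e = 0) :
    ∃ N ⊆ F, PairwiseVertexDisjoint N ∧
      ∑ e, y e - ∑ v : V, max ((∑ e with v ∈ e, y e) - 1) 0 ≤ N.card := by
  obtain ⟨N, hN, hd, C, hC, hcard⟩ := exists_matching_card_eq_cover F side hF
  refine ⟨N, hN, hd, ?_⟩
  rw [← hcard]
  -- Every edge of `F` is counted at least once at the cover.
  have h1 : ∑ e, y e ≤ ∑ v ∈ C, ∑ e with v ∈ e, y e := by
    simp_rw [Finset.sum_filter]
    rw [Finset.sum_comm]
    refine Finset.sum_le_sum fun e _ => ?_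
    have hnn : ∀ v ∈ C, 0 ≤ if v ∈ e then y e else 0 := fun v _ => by
      split_ifs
      exacts [hy e, le_rfl]
    by_cases he : e ∈ F
    · obtain ⟨v, hv, hve⟩ := hC e he
      simpa [hve] using Finset.single_le_sum hnn hv
    · rw [hyF e he]
      simp
  have h2 : ∑ v ∈ C, ∑ e with v ∈ e, y e ≤
      ∑ v ∈ C, (1 + max ((∑ e with v ∈ e, y e) - 1) 0) :=
    Finset.sum_le_sum fun v _ => by linarith [le_max_left ((∑ e with v ∈ e, y e) - 1) 0]
  have h3 : ∑ v ∈ C, max ((∑ e with v ∈ e, y e) - 1) 0 ≤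
      ∑ v : V, max ((∑ e with v ∈ e, y e) - 1) 0 :=
    Finset.sum_le_sum_of_subset_of_nonneg (Finset.subset_univ C) fun v _ _ => le_max_right _ _
  rw [Finset.sum_add_distrib, Finset.sum_const, nsmul_one] at h2
  linarith

end Konig

/-! ### Random variables with finitely many values -/

section FiniteValued

variable {Ω α β : Type*} [MeasurableSpace Ω]

lemma integrable_comp_of_finite [Fintype α] {μ : Measure Ω} [IsFiniteMeasure μ] {g : Ω → α}
    (hg : ∀ a, MeasurableSet {ω | g ω = a}) (h : α → ℝ) : Integrable (fun ω => h (g ω)) μ := by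
  let _ : MeasurableSpace α := ⊤
  have hgm : Measurable g := measurable_to_countable' hg
  have hm : Measurable fun ω => h (g ω) := measurable_from_top.comp hgm
  refine Integrable.of_bound hm.aestronglyMeasurable (∑ a, |h a|) (ae_of_all _ fun ω => ?_)
  exact Finset.single_le_sum (f := fun a => |h a|) (fun a _ => abs_nonneg _) (Finset.mem_univ _)

lemma measurableSet_prodMk_eq {f : Ω → α} {g : Ω → β} (hf : ∀ a, MeasurableSet {ω | f ω = a})
    (hg : ∀ b, MeasurableSet {ω | g ω = b}) (p : α × β) :
    MeasurableSet {ω | (f ω, g ω) = p} := by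
  have : {ω | (f ω, g ω) = p} = {ω | f ω = p.1} ∩ {ω | g ω = p.2} := by
    ext ω
    simp [Prod.ext_iff]
  rw [this]
  exact (hf _).inter (hg _)

lemma measurableSet_comp_eq [Countable α] {f : Ω → α} (hf : ∀ a, MeasurableSet {ω | f ω = a})
    (h : α → β) (b : β) : MeasurableSet {ω | h (f ω) = b} := by
  have : {ω | h (f ω) = b} = ⋃ a, ⋃ (_ : h a = b), {ω | f ω = a} := by
    ext ω
    simp
  rw [this]
  exact MeasurableSet.iUnion fun a => MeasurableSet.iUnion fun _ => hf a

end FiniteValued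

/-! ### Uniform thresholds -/

lemma volume_real_unitInterval_lt {a : ℝ} (ha : 0 ≤ a) :
    (volume : Measure unitInterval).real {u | (u : ℝ) < a} = min a 1 := by
  by_cases h : a ≤ 1
  · have : {u : unitInterval | (u : ℝ) < a} = Set.Iio ⟨a, ha, h⟩ := by
      ext u
      simp [← Subtype.coe_lt_coe]
    rw [this, measureReal_def, unitInterval.volume_Iio, ENNReal.toReal_ofReal ha, min_eq_left h]
  · push Not at h
    have : {u : unitInterval | (u : ℝ) < a} = Set.univ := by
      ext u
      simpa using u.2.2.trans_lt h
    rw [this, probReal_univ, min_eq_right h.le]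

lemma volume_real_unitInterval_symmDiff_lt_le (a b : ℝ) :
    (volume : Measure unitInterval).real (symmDiff {u | (u : ℝ) < a} {u | (u : ℝ) < b}) ≤
      |a - b| := by
  have hsub : symmDiff {u : unitInterval | (u : ℝ) < a} {u | (u : ℝ) < b} ⊆
      Subtype.val ⁻¹' Set.Ico (min a b) (max a b) := by
    intro u hu
    simp only [Set.mem_symmDiff, Set.mem_ofPred_eq, not_lt] at hu
    simp only [Set.mem_preimage, Set.mem_Ico, min_le_iff, lt_max_iff]
    tauto
  refine (measureReal_mono hsub).trans ?_
  rw [unitInterval.measurePreserving_coe.measureReal_preimage measurableSet_Ico.nullMeasurableSet]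
  rw [measureReal_restrict_apply measurableSet_Ico]
  refine (measureReal_mono Set.inter_subset_left (by simp)).trans ?_
  rw [Real.volume_real_Ico_of_le min_le_max, max_sub_min_eq_abs, abs_sub_comm]

/-- The unbiased estimator of `a` obtained by keeping it with probability `min (L a) 1`, that is,
if the uniform threshold `u` is less than `L a`. -/
noncomputable def thresholdWeight (L a : ℝ) (u : unitInterval) : ℝ :=
  if (u : ℝ) < L * a then max a (1 / L) else 0

section thresholdWeight

variable {L a : ℝ}

lemma measurable_thresholdWeight : Measurable (thresholdWeight L a) :=
  Measurable.ite (measurableSet_lt measurable_subtype_coe measurable_const)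
    measurable_const measurable_const

lemma thresholdWeight_mem_Icc (ha : 0 ≤ a) (u : unitInterval) :
    thresholdWeight L a u ∈ Set.Icc 0 (max a (1 / L)) := by
  unfold thresholdWeight
  have : 0 ≤ max a (1 / L) := ha.trans (le_max_left _ _)
  split_ifs
  exacts [⟨this, le_rfl⟩, ⟨le_rfl, this⟩]

lemma memLp_thresholdWeight (ha : 0 ≤ a) : MemLp (thresholdWeight L a) 2 volume :=
  memLp_of_bounded (ae_of_all _ fun u => thresholdWeight_mem_Icc ha u)
    measurable_thresholdWeight.aestronglyMeasurable 2

lemma integral_thresholdWeight (hL : 0 < L) (ha : 0 ≤ a) : ∫ u, thresholdWeight L a u = a := by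
  have : thresholdWeight L a =
      Set.indicator {u : unitInterval | (u : ℝ) < L * a} fun _ => max a (1 / L) := by
    ext u
    simp [thresholdWeight, Set.indicator_apply]
  rw [this, integral_indicator_const _ (measurableSet_lt measurable_subtype_coe measurable_const),
    volume_real_unitInterval_lt (by positivity), smul_eq_mul]
  rcases le_total (L * a) 1 with h | h
  · rw [min_eq_left h, max_eq_right]
    · field_simp
    · rw [le_div_iff₀ hL]; linarith
  · rw [min_eq_right h, max_eq_left, one_mul]
    rw [div_le_iff₀ hL]; linarith

/-- A variable in `[0, b]` with mean `a` has variance at most `(b - a) * a`, and here `b - a ≤ 1 /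
L`. -/
lemma variance_thresholdWeight_le (hL : 0 < L) (ha : 0 ≤ a) :
    Var[thresholdWeight L a; volume] ≤ a / L := by
  have h := variance_le_sub_mul_sub (ae_of_all volume fun u => thresholdWeight_mem_Icc (L := L) ha u)
    measurable_thresholdWeight.aemeasurable
  rw [integral_thresholdWeight hL ha] at h
  have h1 : max a (1 / L) - a ≤ 1 / L := by
    have : 0 < 1 / L := by positivity
    rcases max_cases a (1 / L) with h | h <;> linarith
  calc _ ≤ _ := h
    _ ≤ 1 / L * (a - 0) := mul_le_mul_of_nonneg_right h1 (by linarith)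
    _ = a / L := by ring

end thresholdWeight

/-! ### The excess over one -/

/-- The bound uses `c * m` rather than `c` so that, once the variance is also of order `m`, summing
over vertices gives a multiple of the fractional value and not of `n`. -/
lemma max_sub_one_le {s m c : ℝ} (hm : 0 ≤ m) (hm1 : m ≤ 1) (hc : 0 < c) (hc1 : c ≤ 1) :
    max (s - 1) 0 ≤ c * m + (s - m) ^ 2 / (4 * c) := by
  refine max_le ?_ (by positivity)
  have h : s - 1 - c * m ≤ (s - m) ^ 2 / (4 * c) := by
    rw [le_div_iff₀ (by positivity)]
    by_cases hn : s - 1 - c * m ≤ 0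
    · nlinarith [sq_nonneg (s - m)]
    · have hd : c ≤ 1 - m + c * m := by nlinarith
      have h1 := mul_le_mul_of_nonneg_left hd (by linarith : 0 ≤ s - 1 - c * m)
      nlinarith [sq_nonneg (s - m - 2 * (1 - m + c * m))]
  linarith

lemma integral_max_sub_one_le {Ω : Type*} [MeasurableSpace Ω] {μ : Measure Ω}
    [IsProbabilityMeasure μ] {X : Ω → ℝ} (hX : MemLp X 2 μ) {m c v : ℝ} (hm : ∫ ω, X ω ∂μ = m)
    (hm0 : 0 ≤ m) (hm1 : m ≤ 1) (hc : 0 < c) (hc1 : c ≤ 1) (hv : Var[X; μ] ≤ v) :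
    ∫ ω, max (X ω - 1) 0 ∂μ ≤ c * m + v / (4 * c) := by
  have hint := (hX.integrable (by norm_num)).sub (integrable_const (1 : ℝ))
  have hsq : Integrable (fun ω => (X ω - m) ^ 2) μ := (hX.sub (memLp_const m)).integrable_sq
  calc ∫ ω, max (X ω - 1) 0 ∂μ ≤ ∫ ω, (c * m + (X ω - m) ^ 2 / (4 * c)) ∂μ :=
        integral_mono hint.pos_part ((integrable_const _).add (hsq.div_const _))
          fun ω => max_sub_one_le hm0 hm1 hc hc1
    _ = c * m + Var[X; μ] / (4 * c) := by
        rw [integral_add (integrable_const _) (hsq.div_const _), integral_div,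
          variance_eq_integral hX.aemeasurable, hm]
        simp
    _ ≤ c * m + v / (4 * c) := by gcongr

/-! ### Sampling the edges of a fractional matching -/

section Sampling

variable {V : Type u} [Fintype V]

open Classical in
/-- The edges `e` whose threshold `ω e` is less than `L x_e`. -/
noncomputable def sampledEdges (L : ℝ) (S : Snapshot V) (ω : Sym2 V → unitInterval) :
    Finset (Sym2 V) :=
  Finset.univ.filter fun e => e ∈ S.graph.edgeSet ∧ (ω e : ℝ) < L * S.frac e

variable (V) in
/-- The law of independent uniform thresholds, one for each pair of vertices. -/
noncomputable def thresholdLaw : Measure (Sym2 V → unitInterval) :=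
  Measure.pi fun _ => volume

instance : IsProbabilityMeasure (thresholdLaw V) := by
  unfold thresholdLaw
  infer_instance

variable {L : ℝ} {S S' : Snapshot V}

lemma mem_sampledEdges {ω : Sym2 V → unitInterval} {e : Sym2 V} :
    e ∈ sampledEdges L S ω ↔ e ∈ S.graph.edgeSet ∧ (ω e : ℝ) < L * S.frac e := by
  simp [sampledEdges]

lemma mem_sampledEdges_iff_lt (hS : ∀ e, e ∉ S.graph.edgeSet → S.frac e = 0)
    {ω : Sym2 V → unitInterval} {e : Sym2 V} :
    e ∈ sampledEdges L S ω ↔ (ω e : ℝ) < L * S.frac e := by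
  rw [mem_sampledEdges, and_iff_right_iff_imp]
  intro h
  by_contra he
  rw [hS e he, mul_zero] at h
  exact (ω e).2.1.not_gt h

lemma sampledEdges_eq_empty (hS : S.frac = 0) (ω : Sym2 V → unitInterval) :
    sampledEdges L S ω = ∅ := by
  ext e
  rw [mem_sampledEdges_iff_lt (by simp [hS]), hS]
  simpa using (ω e).2.1

lemma measurableSet_sampledEdges_eq (A : Finset (Sym2 V)) :
    MeasurableSet {ω | sampledEdges L S ω = A} := by
  have : {ω | sampledEdges L S ω = A} = ⋂ e, {ω | e ∈ sampledEdges L S ω ↔ e ∈ A} := by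
    ext ω
    simp [Finset.ext_iff]
  rw [this]
  refine MeasurableSet.iInter fun e => ?_
  have hm : MeasurableSet {ω : Sym2 V → unitInterval | e ∈ sampledEdges L S ω} := by
    simp only [mem_sampledEdges]
    have hlt : MeasurableSet {ω : Sym2 V → unitInterval | (ω e : ℝ) < L * S.frac e} :=
      measurableSet_lt (measurable_subtype_coe.comp (measurable_pi_apply e)) measurable_const
    exact (MeasurableSet.const _).inter hlt
  by_cases he : e ∈ A
  · simpa [he] using hm
  · simp only [he, iff_false]
    exact hm.compl

lemma integral_comp_eval_thresholdLaw {f : unitInterval → ℝ} (hf : Measurable f) (e : Sym2 V) :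
    ∫ ω, f (ω e) ∂(thresholdLaw V) = ∫ u, f u :=
  integral_comp_eval (μ := fun _ : Sym2 V => (volume : Measure unitInterval))
    hf.aestronglyMeasurable

lemma memLp_thresholdWeight_eval {a : ℝ} (ha : 0 ≤ a) (e : Sym2 V) :
    MemLp (fun ω => thresholdWeight L a (ω e)) 2 (thresholdLaw V) :=
  (memLp_thresholdWeight ha).comp_measurePreserving
    (measurePreserving_eval (fun _ : Sym2 V => (volume : Measure unitInterval)) e)

lemma integral_sum_thresholdWeight (hL : 0 < L) {x : Sym2 V → ℝ} (hx : ∀ e, 0 ≤ x e)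
    (A : Finset (Sym2 V)) :
    ∫ ω, ∑ e ∈ A, thresholdWeight L (x e) (ω e) ∂(thresholdLaw V) = ∑ e ∈ A, x e := by
  rw [integral_finsetSum _ fun e _ => (memLp_thresholdWeight_eval (hx e) e).integrable (by norm_num)]
  refine Finset.sum_congr rfl fun e _ => ?_
  rw [integral_comp_eval_thresholdLaw measurable_thresholdWeight, integral_thresholdWeight hL (hx e)]

variable [DecidableEq V]

/-- Both samples use the same thresholds, so a pair changes status only when its threshold lies
between the two scaled values. -/
lemma integral_card_symmDiff_sampledEdges_le (hL : 0 ≤ L)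
    (hS : ∀ e, e ∉ S.graph.edgeSet → S.frac e = 0)
    (hS' : ∀ e, e ∉ S'.graph.edgeSet → S'.frac e = 0) :
    ∫ ω, ((symmDiff (sampledEdges L S ω) (sampledEdges L S' ω)).card : ℝ) ∂(thresholdLaw V) ≤
      L * l1Dist S.frac S'.frac := by
  let A : Sym2 V → Set unitInterval := fun e =>
    symmDiff {u | (u : ℝ) < L * S.frac e} {u | (u : ℝ) < L * S'.frac e}
  have hA : ∀ e, MeasurableSet (A e) := fun e => by
    have h1 : MeasurableSet {u : unitInterval | (u : ℝ) < L * S.frac e} :=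
      measurableSet_lt measurable_subtype_coe measurable_const
    have h2 : MeasurableSet {u : unitInterval | (u : ℝ) < L * S'.frac e} :=
      measurableSet_lt measurable_subtype_coe measurable_const
    exact (h1.diff h2).union (h2.diff h1)
  have hcard : ∀ ω, ((symmDiff (sampledEdges L S ω) (sampledEdges L S' ω)).card : ℝ) =
      ∑ e, (Function.eval e ⁻¹' A e).indicator (fun _ => (1 : ℝ)) ω := by
    intro ω
    rw [Finset.card_eq_sum_ones, ← Finset.sum_subset (Finset.subset_univ _)]
    · push_cast
      refine Finset.sum_congr rfl fun e he => ?_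
      rw [Finset.mem_symmDiff, mem_sampledEdges_iff_lt hS, mem_sampledEdges_iff_lt hS'] at he
      rw [Set.indicator_of_mem (show ω ∈ Function.eval e ⁻¹' A e from he)]
    · intro e _ he
      rw [Finset.mem_symmDiff, mem_sampledEdges_iff_lt hS, mem_sampledEdges_iff_lt hS'] at he
      rw [Set.indicator_of_notMem (show ω ∉ Function.eval e ⁻¹' A e from he)]
  have hm : ∀ e, MeasurableSet (Function.eval e ⁻¹' A e : Set (Sym2 V → unitInterval)) :=
    fun e => measurable_pi_apply e (hA e)
  simp_rw [hcard]
  rw [integral_finsetSum _ fun e _ => (integrable_const (1 : ℝ)).indicator (hm e), l1Dist,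
    Finset.mul_sum]
  refine Finset.sum_le_sum fun e _ => ?_
  rw [integral_indicator_const _ (hm e), smul_eq_mul, mul_one, thresholdLaw,
    (measurePreserving_eval (fun _ : Sym2 V => (volume : Measure unitInterval)) e).measureReal_preimage
      (hA e).nullMeasurableSet]
  refine (volume_real_unitInterval_symmDiff_lt_le _ _).trans_eq ?_
  rw [← mul_sub, abs_mul, abs_of_nonneg hL]

lemma variance_sum_thresholdWeight_le (hL : 0 < L) {x : Sym2 V → ℝ} (hx : ∀ e, 0 ≤ x e)
    (A : Finset (Sym2 V)) :
    Var[fun ω => ∑ e ∈ A, thresholdWeight L (x e) (ω e); thresholdLaw V] ≤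
      (∑ e ∈ A, x e) / L := by
  -- Padding by zero outside `A` turns the sum into one over all independent coordinates.
  have hmem : ∀ e, MemLp (fun u => if e ∈ A then thresholdWeight L (x e) u else 0) 2 volume := by
    intro e
    by_cases he : e ∈ A
    · simpa [he] using memLp_thresholdWeight (hx e)
    · simp [he]
  have h := variance_sum_pi hmem
  have heq : (∑ e, fun ω : Sym2 V → unitInterval =>
      if e ∈ A then thresholdWeight L (x e) (ω e) else 0) =
      fun ω => ∑ e ∈ A, thresholdWeight L (x e) (ω e) := by
    ext ω
    simp [Finset.sum_apply]
  rw [heq] at h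
  rw [thresholdLaw, h, Finset.sum_div, ← Finset.sum_subset (Finset.subset_univ A)]
  · refine Finset.sum_le_sum fun e he => ?_
    simpa [he] using variance_thresholdWeight_le hL (hx e)
  · intro e _ he
    simp only [he, if_false]
    exact variance_zero _

/-- Handshake identity; vanishing off the edges excludes the diagonal pairs, which have a single
endpoint. -/
lemma sum_sum_mem_eq_two_mul {G : SimpleGraph V} {x : Sym2 V → ℝ}
    (hx : ∀ e, e ∉ G.edgeSet → x e = 0) :
    ∑ v : V, ∑ e with v ∈ e, x e = 2 * ∑ e, x e := by
  simp_rw [Finset.sum_filter]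
  rw [Finset.sum_comm, Finset.mul_sum]
  refine Finset.sum_congr rfl fun e _ => ?_
  by_cases he : e ∈ G.edgeSet
  · rw [← Finset.sum_filter, Finset.sum_const, nsmul_eq_mul]
    congr 1
    induction e with
    | h v w =>
      have hne : v ≠ w := G.ne_of_adj he
      have : (Finset.univ.filter fun a => a ∈ s(v, w)) = {v, w} := by
        ext a
        simp
      rw [this, Finset.card_pair hne]
      norm_num
  · simp [hx e he]

/-- In expectation, the sampled edges of a fractional matching `x` of a bipartite graph contain a
matching of almost the value of `x`. -/
lemma le_integral_of_matching_le (hL : 0 < L) (hG : S.graph.IsBipartite)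
    (hS : IsFractionalMatching S.graph S.frac) {c : ℝ} (hc : 0 < c) (hc1 : c ≤ 1)
    {f : (Sym2 V → unitInterval) → ℝ} (hf : Integrable f (thresholdLaw V))
    (hle : ∀ ω, ∀ N ⊆ sampledEdges L S ω, PairwiseVertexDisjoint N → (N.card : ℝ) ≤ f ω) :
    (1 - (2 * c + 1 / (2 * c * L))) * ∑ e, S.frac e ≤ ∫ ω, f ω ∂(thresholdLaw V) := by
  let Y : Sym2 V → (Sym2 V → unitInterval) → ℝ := fun e ω => thresholdWeight L (S.frac e) (ω e)
  obtain ⟨col⟩ := hG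
  -- König's theorem is applied for each seed separately, with the random weights `Y`; `f` dominates
  -- the resulting matching, so no measurable choice of it is required.
  have hpt : ∀ ω, ∑ e, Y e ω - ∑ v : V, max ((∑ e with v ∈ e, Y e ω) - 1) 0 ≤ f ω := by
    intro ω
    obtain ⟨N, hN, hd, hcard⟩ := exists_matching_ge_weight_sub_excess (sampledEdges L S ω)
      (fun v => decide (col v = 0))
      (by
        intro v w hvw
        have hadj : S.graph.Adj v w := (mem_sampledEdges.1 hvw).1
        have hne := col.valid hadj
        simp only [ne_eq, decide_eq_decide]
        omega)
      (fun e => Y e ω) (fun e => (thresholdWeight_mem_Icc (hS.nonneg e) _).1)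
      (by
        intro e he
        rw [mem_sampledEdges_iff_lt hS.eq_zero_of_notMem] at he
        simp [Y, thresholdWeight, he])
    exact hcard.trans (hle ω N hN hd)
  have hmem : ∀ A : Finset (Sym2 V), MemLp (fun ω => ∑ e ∈ A, Y e ω) 2 (thresholdLaw V) :=
    fun A => memLp_finsetSum _ fun e _ => memLp_thresholdWeight_eval (hS.nonneg e) e
  have hintA : ∀ A : Finset (Sym2 V), Integrable (fun ω => ∑ e ∈ A, Y e ω) (thresholdLaw V) :=
    fun A => (hmem A).integrable (by norm_num)
  have hintV : ∀ v : V, Integrable (fun ω => max ((∑ e with v ∈ e, Y e ω) - 1) 0)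
      (thresholdLaw V) := fun v => ((hintA _).sub (integrable_const 1)).pos_part
  have h := integral_mono
    ((hintA Finset.univ).sub (integrable_finsetSum Finset.univ fun v _ => hintV v)) hf hpt
  simp only [Pi.sub_apply] at h
  rw [integral_sub (hintA _) (integrable_finsetSum _ fun v _ => hintV v),
    integral_finsetSum _ fun v _ => hintV v,
    integral_sum_thresholdWeight hL hS.nonneg] at h
  have hv : ∀ v : V, ∫ ω, max ((∑ e with v ∈ e, Y e ω) - 1) 0 ∂(thresholdLaw V) ≤
      (c + 1 / (4 * c * L)) * ∑ e with v ∈ e, S.frac e := by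
    intro v
    refine (integral_max_sub_one_le (hmem _) (integral_sum_thresholdWeight hL hS.nonneg _)
      (Finset.sum_nonneg fun e _ => hS.nonneg e) (hS.degree_le_one v) hc hc1
      (variance_sum_thresholdWeight_le hL hS.nonneg _)).trans_eq ?_
    field_simp
  have hsum := Finset.sum_le_sum fun v (_ : v ∈ Finset.univ) => hv v
  rw [← Finset.mul_sum, sum_sum_mem_eq_two_mul hS.eq_zero_of_notMem] at hsum
  have hid : (c + 1 / (4 * c * L)) * (2 * ∑ e, S.frac e) =
      (2 * c + 1 / (2 * c * L)) * ∑ e, S.frac e := by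
    field_simp
    ring
  rw [hid] at hsum
  linarith

end Sampling

/-! ### The rounding scheme -/

section Scheme

variable {V : Type u} [Fintype V] [DecidableEq V]

/-- The lazy matchings in the sampled edge sets. -/
noncomputable def sampledMatching (K L : ℝ) (I : ℕ → Snapshot V) (t : ℕ)
    (ω : Sym2 V → unitInterval) : Finset (Sym2 V) :=
  lazyMatchings K (fun s => sampledEdges L (I s) ω) t

/-- Each matching is a function of two finite-valued variables, the current sample and the previous
matching. -/
lemma measurableSet_sampledMatching_eq (K L : ℝ) (I : ℕ → Snapshot V) (t : ℕ)
    (M : Finset (Sym2 V)) : MeasurableSet {ω | sampledMatching K L I t ω = M} := by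
  induction t generalizing M with
  | zero =>
    simp only [sampledMatching, lazyMatchings]
    exact MeasurableSet.const _
  | succ t ih =>
    exact measurableSet_comp_eq
      (measurableSet_prodMk_eq (fun A => measurableSet_sampledEdges_eq (L := L) (S := I (t + 1)) A)
        ih) (fun p => lazyMatching K p.1 p.2) M

variable (V) in
/-- Sample the edges with independent uniform thresholds and maintain a lazy matching among the
sampled edges. -/
noncomputable def samplingScheme (K L : ℝ) : RoundingScheme V where
  Ω := Sym2 V → unitInterval
  P := thresholdLaw V
  sol := sampledMatching K L
  sol_zero _ _ := rfl
  causal I J t h := by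
    ext1 ω
    exact lazyMatchings_congr K fun s hs => by rw [h s hs]
  measurableSet_sol := measurableSet_sampledMatching_eq K L

variable {K L : ℝ} {I : ℕ → Snapshot V} {T : ℕ}

lemma isMatchingOf_sampledMatching (t : ℕ) (ω : Sym2 V → unitInterval) :
    IsMatchingOf (I t).graph (sampledMatching K L I t ω) :=
  ⟨fun _ he => (mem_sampledEdges.1 (lazyMatchings_subset K _ t he)).1,
    lazyMatchings_pairwiseVertexDisjoint K _ t⟩

lemma expectedRecourse_samplingScheme_le (hK : 0 ≤ K) (hL : 0 ≤ L) (h0 : (I 0).frac = 0)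
    (hI : ∀ t ∈ Finset.Icc 1 T, IsFractionalMatching (I t).graph (I t).frac) :
    (samplingScheme V K L).expectedRecourse I T ≤
      (K + 1) * L * ∑ t ∈ Finset.Icc 1 T, l1Dist (I t).frac (I (t - 1)).frac := by
  have hM : ∀ t ∈ Finset.Icc 1 T, Integrable (fun ω =>
      ((symmDiff (sampledMatching K L I t ω) (sampledMatching K L I (t - 1) ω)).card : ℝ))
      (thresholdLaw V) := fun t _ =>
    integrable_comp_of_finite (measurableSet_prodMk_eq (measurableSet_sampledMatching_eq K L I t)
      (measurableSet_sampledMatching_eq K L I (t - 1))) fun p => ((symmDiff p.1 p.2).card : ℝ)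
  have hH : ∀ t ∈ Finset.Icc 1 T, Integrable (fun ω =>
      ((symmDiff (sampledEdges L (I t) ω) (sampledEdges L (I (t - 1)) ω)).card : ℝ))
      (thresholdLaw V) := fun t _ =>
    integrable_comp_of_finite (measurableSet_prodMk_eq measurableSet_sampledEdges_eq
      measurableSet_sampledEdges_eq) fun p => ((symmDiff p.1 p.2).card : ℝ)
  -- Nothing is assumed about the graph at time `0`; there the claim comes from `h0`.
  have hoff : ∀ t ≤ T, ∀ e, e ∉ (I t).graph.edgeSet → (I t).frac e = 0 := by
    intro t ht e he
    rcases Nat.eq_zero_or_pos t with rfl | hpos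
    · rw [h0]; rfl
    · exact (hI t (Finset.mem_Icc.2 ⟨hpos, ht⟩)).eq_zero_of_notMem e he
  calc (samplingScheme V K L).expectedRecourse I T
      ≤ ∫ ω, (K + 1) * ∑ t ∈ Finset.Icc 1 T,
          ((symmDiff (sampledEdges L (I t) ω) (sampledEdges L (I (t - 1)) ω)).card : ℝ)
            ∂(thresholdLaw V) :=
        integral_mono (integrable_finsetSum _ hM) ((integrable_finsetSum _ hH).const_mul _)
          fun ω => sum_card_symmDiff_lazyMatchings_le K _ hK (sampledEdges_eq_empty h0 ω) T
    _ ≤ (K + 1) * (L * ∑ t ∈ Finset.Icc 1 T, l1Dist (I t).frac (I (t - 1)).frac) := by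
        rw [integral_const_mul, integral_finsetSum _ hH]
        refine mul_le_mul_of_nonneg_left ?_ (add_nonneg hK zero_le_one)
        rw [Finset.mul_sum]
        refine Finset.sum_le_sum fun t ht => ?_
        have htT := (Finset.mem_Icc.1 ht).2
        exact integral_card_symmDiff_sampledEdges_le hL (hoff t htT) (hoff (t - 1) (by omega))
    _ = _ := by ring

lemma le_expectedSize_samplingScheme (hK : 1 < K) (hL : 0 < L) {t : ℕ} (ht : 1 ≤ t)
    (hG : (I t).graph.IsBipartite) (hI : IsFractionalMatching (I t).graph (I t).frac) {c : ℝ}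
    (hc : 0 < c) (hc1 : c ≤ 1) :
    (1 - (2 * c + 1 / (2 * c * L))) * ∑ e, (I t).frac e ≤
      (K + 1) / (K - 1) * (samplingScheme V K L).expectedSize I t := by
  have hint : Integrable (fun ω => ((sampledMatching K L I t ω).card : ℝ)) (thresholdLaw V) :=
    integrable_comp_of_finite (measurableSet_sampledMatching_eq K L I t) fun M => (M.card : ℝ)
  refine (le_integral_of_matching_le hL hG hI hc hc1 (hint.const_mul ((K + 1) / (K - 1)))
    fun ω N hN hd => ?_).trans_eq (integral_const_mul _ _)
  have h := card_le_card_lazyMatchings K (fun s => sampledEdges L (I s) ω) ht hN hd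
  rw [div_mul_eq_mul_div, le_div_iff₀ (by linarith), mul_comm]
  exact h

omit [DecidableEq V] in
lemma frac_eq_zero_of_card_le_one (hV : Fintype.card V ≤ 1) {G : SimpleGraph V}
    {x : Sym2 V → ℝ} (hx : ∀ e, e ∉ G.edgeSet → x e = 0) : x = 0 := by
  have := Fintype.card_le_one_iff_subsingleton.1 hV
  ext e
  refine hx e fun he => ?_
  induction e with
  | h v w => exact G.ne_of_adj he (Subsingleton.elim v w)

lemma fractionalValue_eq_sum {G : SimpleGraph V} {x : Sym2 V → ℝ}
    (hx : ∀ e, e ∉ G.edgeSet → x e = 0) : fractionalValue G x = ∑ e, x e := by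
  unfold fractionalValue
  refine Finset.sum_subset (Finset.subset_univ _) fun e _ he => hx e fun h => he ?_
  simpa using h

end Scheme

end MatchingRounding

open MatchingRounding in
theorem mainTheorem5 :
    ∃ C : ℝ, 0 < C ∧
      ∀ (V : Type u) [Fintype V] [DecidableEq V] (δ α : ℝ), 0 < δ → δ < 1 → 1 ≤ α →
        ∃ R : RoundingScheme V,
          ∀ (I : ℕ → Snapshot V) (T : ℕ),
            (I 0).frac = 0 →
            (∀ t ∈ Finset.Icc 1 T, (I t).graph.IsBipartite ∧
              IsFractionalMatching (I t).graph (I t).frac) →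
            (∀ t ∈ Finset.Icc 1 T, ∀ ω, IsMatchingOf (I t).graph (R.sol I t ω)) ∧
            R.expectedRecourse I T ≤
              C * (α * Real.log (Fintype.card V) / δ ^ 3) *
                  ∑ t ∈ Finset.Icc 1 T, l1Dist (I t).frac (I (t - 1)).frac
                + C * (T / (δ * (Fintype.card V : ℝ) ^ α)) ∧
            ∀ t ∈ Finset.Icc 1 T,
              (1 - δ) * fractionalValue (I t).graph (I t).frac ≤ R.expectedSize I t := by
  -- The recourse factor is `(K + 1) * L = 16 * (4 + δ) / δ ^ 3 ≤ 80 / δ ^ 3`, and `α * log n ≥ 1/2`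
  -- once `n ≥ 2`; hence `160`.
  refine ⟨160, by norm_num, fun V _ _ δ α hδ hδ1 hα =>
    ⟨samplingScheme V (4 / δ) (16 / δ ^ 2), fun I T h0 hI => ⟨?_, ?_, ?_⟩⟩⟩
  · exact fun t _ ω => isMatchingOf_sampledMatching t ω
  · have hrec := expectedRecourse_samplingScheme_le (K := 4 / δ) (L := 16 / δ ^ 2)
      (by positivity) (by positivity) h0 fun t ht => (hI t ht).2
    have hdist : ∀ t, 0 ≤ l1Dist (I t).frac (I (t - 1)).frac := fun t =>
      Finset.sum_nonneg fun e _ => abs_nonneg _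
    have hadd : (0 : ℝ) ≤ 160 * (T / (δ * (Fintype.card V : ℝ) ^ α)) := by positivity
    refine hrec.trans (le_add_of_le_of_nonneg ?_ hadd)
    rcases Nat.lt_or_ge 1 (Fintype.card V) with hV | hV
    · refine mul_le_mul_of_nonneg_right ?_ (Finset.sum_nonneg fun t _ => hdist t)
      have hlog : (1 / 2 : ℝ) ≤ Real.log (Fintype.card V) :=
        (by linarith [Real.log_two_gt_d9] : (1 / 2 : ℝ) ≤ Real.log 2).trans
          (Real.log_le_log (by norm_num) (by exact_mod_cast hV))
      have hαlog : (1 / 2 : ℝ) ≤ α * Real.log (Fintype.card V) := by nlinarith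
      have hleft : (4 / δ + 1) * (16 / δ ^ 2) = 16 * (4 + δ) / δ ^ 3 := by
        field_simp
      rw [hleft, ← mul_div_assoc]
      exact div_le_div_of_nonneg_right (by linarith) (by positivity)
    -- For `n ≤ 1` the logarithm vanishes, but there are no edges and nothing ever moves.
    · have hzero : ∀ t ≤ T, (I t).frac = 0 := by
        intro t ht
        rcases Nat.eq_zero_or_pos t with rfl | hpos
        · exact h0
        · exact frac_eq_zero_of_card_le_one hV
            (hI t (Finset.mem_Icc.2 ⟨hpos, ht⟩)).2.eq_zero_of_notMem
      have hsum : ∑ t ∈ Finset.Icc 1 T, l1Dist (I t).frac (I (t - 1)).frac = 0 :=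
        Finset.sum_eq_zero fun t ht => by
          have htT := (Finset.mem_Icc.1 ht).2
          rw [hzero t htT, hzero (t - 1) (by omega)]
          simp [l1Dist]
      simp [hsum]
  · intro t ht
    obtain ⟨hG, hx⟩ := hI t ht
    have hK : 1 < 4 / δ := by
      rw [lt_div_iff₀ hδ]
      linarith
    have h := le_expectedSize_samplingScheme (K := 4 / δ) (L := 16 / δ ^ 2) hK (by positivity)
      (Finset.mem_Icc.1 ht).1 hG hx (c := δ / 8) (by positivity) (by linarith)
    rw [fractionalValue_eq_sum hx.eq_zero_of_notMem]
    have hval : 0 ≤ ∑ e, (I t).frac e := Finset.sum_nonneg fun e _ => hx.nonneg e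
    -- The choice `c = δ / 8` makes both loss terms equal to `δ / 4`.
    have hloss : 2 * (δ / 8) + 1 / (2 * (δ / 8) * (16 / δ ^ 2)) = δ / 2 := by
      field_simp
      norm_num
    have hratio : (4 / δ + 1) / (4 / δ - 1) = (4 + δ) / (4 - δ) := by
      have h4 : 4 - δ ≠ 0 := by linarith
      have h4' : 4 / δ - 1 ≠ 0 := by linarith
      field_simp
    rw [hloss, hratio, div_mul_eq_mul_div, le_div_iff₀ (by linarith)] at h
    -- Sampling and laziness each lose about `δ / 2`; the two sides differ by `3 * δ ^ 2 / 2`.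
    have hfactor : (1 - δ) * (4 + δ) ≤ (1 - δ / 2) * (4 - δ) := by nlinarith
    have := mul_le_mul_of_nonneg_right hfactor hval
    have hpos : 0 < 4 + δ := by linarith
    refine le_of_mul_le_mul_left ?_ hpos
    linarith
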